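/- Let $d\ge 2$, let $\mathbf g$ be a standard Gaussian random vector in $\mathbb R^d$ and let $\gamma_d$ be its distribution. A polyhedral cone is an intersection of finitely many closed half-spaces of $\mathbb R^d$ whose boundaries contain the origin $o$. For such a cone $C$ let $C^\circ=\{x:\langle x,y\rangle\le 0 \text{ for all } y\in C\}$, let $\Pi_C(x)$ be the point of $C$ nearest to $x$, and let the angular distance be $d_a(x,C)=\arccos(\|\Pi_C(x)\|/\|x\|)$ for $x\ne o$, with $d_a(o,C)=\pi/2$. Let $\mathrm{skel}_k(C)$ be the union of the relative interiors of the $k$-dimensional faces of $C$. Let $\widehat{\mathcal B}$ be the system of Borel sets $\eta\subseteq\mathbb R^d\times\mathbb R^d$ such that $(x,y)\in\eta$ implies $(ax,by)\in\eta$ for all $a,b>0$. For $\eta\in\widehat{\mathcal B}$, the conic support measures of $C$ are $$\Omega_k(C,\eta)=\mathbb P\{\Pi_C(\mathbf g)\in \mathrm{skel}_k(C),\ (\Pi_C(\mathbf g),\Pi_{C^\circ}(\mathbf g))\in\eta\},$$ and, for $0\le\lambda<\pi/2$, the angular local parallel set is $$M^a_\lambda(C,\eta)=\{x\in\mathbb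 R^d: d_a(x,C)\le\lambda,\ (\Pi_C(x),\Pi_{C^\circ}(x))\in\eta\}.$$ **Theorem.** Let $C\subseteq\mathbb R^d$ be a polyhedral cone of positive dimension, let $\eta\in\widehat{\mathcal B}$ and $0\le\lambda<\pi/2$. Then $$\gamma_d(M^a_\lambda(C,\eta))=\sum_{k=1}^d g_k(\lambda)\,\Omega_k(C,\eta),$$ where, with $\omega_n=2\pi^{n/2}/\Gamma(n/2)$, $$g_k(\lambda)=\frac{\omega_k\,\omega_{d-k}}{\omega_d}\int_0^\lambda\cos^{k-1}\varphi\,\sin^{d-k-1}\varphi\,\mathrm d\varphi\quad (k=1,\dots,d-1),\qquad g_d\equiv 1.$$ -/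

import Mathlib

open MeasureTheory ProbabilityTheory

namespace ConicSupport

/-- The Euclidean space `ℝ^d`, with its Euclidean norm. -/
abbrev Euc (d : ℕ) : Type := EuclideanSpace ℝ (Fin d)

/-- A cone is polyhedral if it is the intersection of finitely many closed half-spaces whose
bounding hyperplanes contain the origin. (A `PointedCone` is a convex cone containing the origin;
it may contain lines.) -/
def IsPolyhedral {d : ℕ} (C : PointedCone ℝ (Euc d)) : Prop :=
  ∃ s : Finset (Euc d), ∀ x : Euc d, x ∈ C ↔ ∀ y ∈ s, inner ℝ x y ≤ 0

/-- The dimension of a cone, that is, the dimension of its linear hull. -/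
noncomputable def dim {d : ℕ} (C : PointedCone ℝ (Euc d)) : ℕ :=
  Module.finrank ℝ (Submodule.span ℝ (C : Set (Euc d)))

/-- The dual (polar) cone `C° = {x : ⟨x, y⟩ ≤ 0 for all y ∈ C}`. -/
def polar {d : ℕ} (C : PointedCone ℝ (Euc d)) : PointedCone ℝ (Euc d) where
  carrier := {x | ∀ y ∈ C, inner ℝ x y ≤ 0}
  zero_mem' := by
    intro y _
    simp
  add_mem' := by
    intro a b ha hb y hy
    rw [inner_add_left]
    exact add_nonpos (ha y hy) (hb y hy)
  smul_mem' := by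
    intro c x hx y hy
    rw [← Nonneg.coe_smul, real_inner_smul_left]
    exact mul_nonpos_of_nonneg_of_nonpos c.2 (hx y hy)

/-- `p` is a nearest point to `x` in the cone `C`. -/
def IsNearest {d : ℕ} (C : PointedCone ℝ (Euc d)) (x p : Euc d) : Prop :=
  p ∈ C ∧ ∀ y ∈ C, ‖x - p‖ ≤ ‖x - y‖

/-- The nearest point map (metric projection) `Π_C` of a cone: the unique nearest point of `C`
to `x`. For closed cones it exists and is unique, see `existsUnique_isNearest`. -/
noncomputable def proj {d : ℕ} (C : PointedCone ℝ (Euc d)) (x : Euc d) : Euc d :=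
  Classical.epsilon (IsNearest C x)

theorem existsUnique_isNearest {d : ℕ} (C : PointedCone ℝ (Euc d))
    (hC : IsClosed (C : Set (Euc d))) (x : Euc d) : ∃! p, IsNearest C x p := by
  have hconv : Convex ℝ (C : Set (Euc d)) := C.convex
  have hne : (C : Set (Euc d)).Nonempty := ⟨0, C.zero_mem⟩
  have : Nonempty (C : Set (Euc d)) := hne.to_subtype
  have hbdd : BddBelow (Set.range fun w : (C : Set (Euc d)) => ‖x - w‖) :=
    ⟨0, by rintro _ ⟨w, rfl⟩; exact norm_nonneg _⟩
  have key : ∀ q, IsNearest C x q → ∀ w ∈ C, inner ℝ (x - q) (w - q) ≤ 0 := by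
    intro q hq
    refine (norm_eq_iInf_iff_real_inner_le_zero hconv hq.1).1 (le_antisymm ?_ ?_)
    · exact le_ciInf fun w => hq.2 w w.2
    · exact ciInf_le hbdd (⟨q, hq.1⟩ : (C : Set (Euc d)))
  obtain ⟨p, hp, hpe⟩ := exists_norm_eq_iInf_of_complete_convex hne hC.isComplete hconv x
  have hp' : IsNearest C x p :=
    ⟨hp, fun y hy => hpe ▸ ciInf_le hbdd (⟨y, hy⟩ : (C : Set (Euc d)))⟩
  refine ⟨p, hp', fun q hq => ?_⟩
  have h1 := key p hp' q hq.1
  have h2 := key q hq p hp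
  have h3 : inner ℝ (q - p) (q - p) ≤ (0 : ℝ) := by
    have e : inner ℝ (q - p) (q - p) = inner ℝ (x - p) (q - p) + inner ℝ (x - q) (p - q) := by
      simp only [inner_sub_left, inner_sub_right]
      ring
    linarith
  rw [real_inner_self_eq_norm_sq] at h3
  have h4 : ‖q - p‖ = 0 := by nlinarith [norm_nonneg (q - p)]
  exact sub_eq_zero.1 (norm_eq_zero.1 h4)

theorem IsPolyhedral.isClosed {d : ℕ} {C : PointedCone ℝ (Euc d)} (hC : IsPolyhedral C) :
    IsClosed (C : Set (Euc d)) := by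
  obtain ⟨s, hs⟩ := hC
  have e : (C : Set (Euc d)) = ⋂ y ∈ s, {x | inner ℝ x y ≤ 0} := by
    ext x
    simp [hs x]
  rw [e]
  exact isClosed_biInter fun y _ => isClosed_le (by fun_prop) continuous_const

theorem isClosed_polar {d : ℕ} (C : PointedCone ℝ (Euc d)) :
    IsClosed (polar C : Set (Euc d)) := by
  have e : (polar C : Set (Euc d)) = ⋂ y ∈ C, {x | inner ℝ x y ≤ 0} := by
    ext x
    simp [polar]
  rw [e]
  exact isClosed_biInter fun y _ => isClosed_le (by fun_prop) continuous_const

/-- The angular distance `d_a(x, C)` of a point from a cone. -/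
noncomputable def angDist {d : ℕ} (x : Euc d) (C : PointedCone ℝ (Euc d)) : ℝ :=
  open Classical in
  if x = 0 then Real.pi / 2 else Real.arccos (‖proj C x‖ / ‖x‖)

/-- The `k`-skeleton of a cone: the union of the relative interiors of its `k`-dimensional
faces. -/
def skel {d : ℕ} (k : ℕ) (C : PointedCone ℝ (Euc d)) : Set (Euc d) :=
  {x | ∃ F : PointedCone ℝ (Euc d), F.IsFaceOf C ∧ dim F = k ∧
    x ∈ intrinsicInterior ℝ (F : Set (Euc d))}

/-- The members of the biconic σ-algebra: Borel sets in `ℝ^d × ℝ^d` that are invariant under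
independent positive dilatations of the two components. -/
def IsBiconic {d : ℕ} (η : Set (Euc d × Euc d)) : Prop :=
  MeasurableSet η ∧
    ∀ x y : Euc d, (x, y) ∈ η → ∀ a b : ℝ, 0 < a → 0 < b → (a • x, b • y) ∈ η

/-- The `k`-th conic support measure of the polyhedral cone `C`, evaluated at `η`: the
probability that a standard Gaussian vector `g` satisfies `Π_C(g) ∈ skel_k C` and
`(Π_C(g), Π_{C°}(g)) ∈ η`. -/
noncomputable def Ω {d : ℕ} (k : ℕ) (C : PointedCone ℝ (Euc d)) (η : Set (Euc d × Euc d)) : ℝ :=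
  (stdGaussian (Euc d)).real {x | proj C x ∈ skel k C ∧ (proj C x, proj (polar C) x) ∈ η}

/-- The angular local parallel set `M^a_lam(C, η)`. -/
def angParallel {d : ℕ} (lam : ℝ) (C : PointedCone ℝ (Euc d)) (η : Set (Euc d × Euc d)) :
    Set (Euc d) :=
  {x | angDist x C ≤ lam ∧ (proj C x, proj (polar C) x) ∈ η}

/-- The total surface measure `ω_n = 2 π^{n/2} / Γ(n/2)` of the unit sphere of `ℝ^n`, `n ≥ 1`. -/
noncomputable def ω (n : ℕ) : ℝ :=
  2 * Real.pi ^ ((n : ℝ) / 2) / Real.Gamma ((n : ℝ) / 2)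

/-- The coefficient functions `g_k`, `k = 1, …, d`, in dimension `d`; `g_d` is constantly `1`. -/
noncomputable def g (d k : ℕ) (lam : ℝ) : ℝ :=
  if k = d then 1
  else ω k * ω (d - k) / ω d *
    ∫ φ in (0 : ℝ)..lam, Real.cos φ ^ (k - 1) * Real.sin φ ^ (d - k - 1)

end ConicSupport

/-! Write `C` as a finite intersection of half-spaces with normals `s`. For a point `x`, let `I` be
the set of normals active at `Π_C(x)` and `L` the orthogonal complement of `I`, which is the span of
the face whose relative interior contains `Π_C(x)`. Then `Π_C(x)` and `Π_{C°}(x)` are the orthogonal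
projections of `x` to `L` and `Lᗮ` (`proj_eq_starProjection`, `proj_polar`). For fixed `I`, the
event that `I` is active and the pair of projections lies in `η` therefore reads `(P_L x, P_{Lᗮ} x)
∈ A` with `A` biconic (`mem_activeEvent_iff`), whereas the angular bound reads `cos λ ‖x‖ ≤ ‖P_L x‖`
(`angDist_le_iff`).

For a Gaussian vector, `P_L g` and `P_{Lᗮ} g` are independent, and each has its direction
independent of its norm. The set `A` sees only the two directions and the angle only the two norms,
so the probability factors (`stdGaussian_biconic_sector`). The second factor depends only on `k =
dim L`: the norms are chi distributed with `k` and `d - k` degrees of freedom, and planar polar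
coordinates turn it into `g_k(λ)` (`radial_prod_sector`).

Summing over `I ⊆ s` and grouping by `dim L`, which is the dimension of the face (`mem_skel_iff`),
gives the formula. Dimension zero contributes nothing because `λ < π/2`. -/

namespace ConicSupport

/-! ### The Gaussian measure in polar coordinates -/

section

open Metric Set

section GaussianDensity

variable (E : Type*) [NormedAddCommGroup E] [InnerProductSpace ℝ E] [FiniteDimensional ℝ E]
  [MeasurableSpace E] [BorelSpace E]

/-- The standard Gaussian measure has a density proportional to `exp (-‖x‖² / 2)`. -/
theorem stdGaussian_eq_withDensity :
    ∃ c : ENNReal, c ≠ ⊤ ∧ stdGaussian E =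
      c • (volume : Measure E).withDensity fun x ↦ ENNReal.ofReal (Real.exp (-‖x‖ ^ 2 / 2)) := by
  set e : E → ℝ := fun x ↦ Real.exp (-‖x‖ ^ 2 / 2)
  -- The Gaussian integral `(2π)^(n/2)`, in the form produced by the Fourier formula with parameter
  -- `1/2`.
  set A : ℝ := (Real.pi / (1 / 2)) ^ (Module.finrank ℝ E / 2 : ℝ)
  have hA : 0 < A := by positivity
  have hre : (0 : ℝ) < (1 / 2 : ℂ).re := by norm_num
  have hint : Integrable e := by
    have h := (GaussianFourier.integrable_cexp_neg_mul_sq_norm_add hre 0 (0 : E)).norm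
    refine h.congr (.of_forall fun x ↦ ?_)
    simp only [e, zero_mul, add_zero, Complex.norm_exp]
    congr 1
    rw [show -(1 / 2 : ℂ) * (‖x‖ : ℂ) ^ 2 = ((-‖x‖ ^ 2 / 2 : ℝ) : ℂ) by push_cast; ring,
      Complex.ofReal_re]
  have hfin : IsFiniteMeasure ((volume : Measure E).withDensity fun x ↦ ENNReal.ofReal (e x)) :=
    isFiniteMeasure_withDensity_ofReal hint.2
  refine ⟨ENNReal.ofReal A⁻¹, ENNReal.ofReal_ne_top, ?_⟩
  have : IsFiniteMeasure (ENNReal.ofReal A⁻¹ •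
      (volume : Measure E).withDensity fun x ↦ ENNReal.ofReal (e x)) :=
    Measure.smul_finite _ ENNReal.ofReal_ne_top
  refine Measure.ext_of_charFun (funext fun t ↦ ?_)
  rw [charFun_stdGaussian, charFun_apply, integral_smul_measure,
    integral_withDensity_eq_integral_toReal_smul (by fun_prop)
      (.of_forall fun _ ↦ ENNReal.ofReal_lt_top), ENNReal.toReal_ofReal (by positivity)]
  have h := GaussianFourier.integral_cexp_neg_mul_sq_norm_add hre Complex.I t
  have h' : ∫ x : E, (ENNReal.ofReal (e x)).toReal • Complex.exp (inner ℝ x t * Complex.I) =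
      A * Complex.exp (-‖t‖ ^ 2 / 2) := by
    convert! h using 1
    · refine integral_congr_ae (.of_forall fun x ↦ ?_)
      simp only [e]
      rw [ENNReal.toReal_ofReal (Real.exp_pos _).le, Complex.real_smul, Complex.ofReal_exp,
        ← Complex.exp_add, real_inner_comm]
      congr 1
      push_cast
      ring
    · congr 1
      · simp only [A]
        rw [Complex.ofReal_cpow (by positivity)]
        push_cast
        rfl
      · congr 1
        rw [Complex.I_sq]
        ring
  rw [h', Complex.real_smul, ← mul_assoc, ← Complex.ofReal_mul, inv_mul_cancel₀ hA.ne',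
    Complex.ofReal_one, one_mul]

end GaussianDensity

/-- The (unnormalised) law of the norm of a standard Gaussian vector in dimension `n`. -/
noncomputable def radial (n : ℕ) : Measure (Ioi (0 : ℝ)) :=
  (Measure.volumeIoiPow (n - 1)).withDensity fun r ↦ ENNReal.ofReal (Real.exp (-r.1 ^ 2 / 2))

instance (n : ℕ) : SFinite (radial n) := by unfold radial; infer_instance

/-- In polar coordinates, the standard Gaussian measure is the product of an angular measure and
the law of the radial part. -/
theorem exists_map_prod_radial_eq_stdGaussian (E : Type*) [NormedAddCommGroup E]
    [InnerProductSpace ℝ E] [FiniteDimensional ℝ E] [MeasurableSpace E] [BorelSpace E]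
    [Nontrivial E] :
    ∃ σ : Measure (sphere (0 : E) 1), SFinite σ ∧
      (σ.prod (radial (Module.finrank ℝ E))).map (fun p ↦ p.2.1 • p.1.1) = stdGaussian E := by
  obtain ⟨c, -, hγ⟩ := stdGaussian_eq_withDensity E
  -- The normalising constant goes into the angular measure, so the radial measure need not have
  -- mass one.
  refine ⟨c • (volume : Measure E).toSphere, inferInstance, ?_⟩
  set P := (volume : Measure E).toSphere.prod (Measure.volumeIoiPow (Module.finrank ℝ E - 1))
  have hm : Measurable fun p : sphere (0 : E) 1 × Ioi (0 : ℝ) ↦ p.2.1 • p.1.1 := by fun_prop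
  have hvol : P.map (fun p ↦ p.2.1 • p.1.1) = volume := by
    have h1 := ((volume : Measure E).measurePreserving_homeomorphUnitSphereProd.symm
      (homeomorphUnitSphereProd E).toMeasurableEquiv).map_eq
    -- Polar coordinates live on the complement of the origin, which is a null set.
    have h2 := map_comap_subtype_coe (measurableSet_singleton (0 : E)).compl volume
    rw [restrict_compl_singleton] at h2
    rw [← h2, ← h1, Measure.map_map measurable_subtype_coe (by fun_prop)]
    rfl
  rw [hγ]
  conv_rhs => rw [← hvol]
  rw [Measure.prod_smul_left, Measure.map_smul]
  congr 1
  ext s hs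
  rw [withDensity_apply _ hs, Measure.restrict_map hm hs, lintegral_map (by fun_prop) hm,
    Measure.map_apply hm hs, radial, prod_withDensity_right (by fun_prop),
    withDensity_apply _ (hm hs)]
  refine lintegral_congr fun p ↦ ?_
  have h1 : ‖p.1.1‖ = 1 := by simp
  rw [norm_smul, h1, mul_one, Real.norm_eq_abs, sq_abs]

end

/-! ### Chi distributions and the coefficients `g_k` -/

section

open Metric Set

/-- The density of the (unnormalised) chi distribution with `n` degrees of freedom. -/
noncomputable def chiDensity (n : ℕ) (r : ℝ) : ℝ := r ^ (n - 1) * Real.exp (-r ^ 2 / 2)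

/-- The total mass `2 ^ (n / 2 - 1) Γ(n / 2)` of the unnormalised chi distribution. -/
noncomputable def chiMass (n : ℕ) : ℝ := 2 ^ ((n : ℝ) / 2 - 1) * Real.Gamma (n / 2)

theorem chiMass_pos {n : ℕ} (hn : 0 < n) : 0 < chiMass n := by
  have : (0 : ℝ) < n / 2 := by positivity
  exact mul_pos (by positivity) (Real.Gamma_pos_of_pos this)

@[fun_prop]
theorem continuous_chiDensity (n : ℕ) : Continuous (chiDensity n) := by
  unfold chiDensity; fun_prop

theorem chiDensity_nonneg (n : ℕ) {r : ℝ} (hr : 0 ≤ r) : 0 ≤ chiDensity n r := by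
  unfold chiDensity; positivity

theorem lintegral_chiDensity {n : ℕ} (hn : 0 < n) :
    ∫⁻ r in Ioi (0 : ℝ), ENNReal.ofReal (chiDensity n r) = ENNReal.ofReal (chiMass n) := by
  have hq : (-1 : ℝ) < (n : ℝ) - 1 := by
    have : (0 : ℝ) < n := by positivity
    linarith
  have hcongr : EqOn (fun r : ℝ ↦ r ^ ((n : ℝ) - 1) * Real.exp (-(1 / 2) * r ^ (2 : ℝ)))
      (chiDensity n) (Ioi 0) := by
    intro r hr
    simp only [chiDensity]
    rw [show ((n : ℝ) - 1) = ((n - 1 : ℕ) : ℝ) by rw [Nat.cast_sub hn]; simp,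
      Real.rpow_natCast, Real.rpow_two]
    congr 2
    ring
  have hint : IntegrableOn (chiDensity n) (Ioi 0) :=
    (integrableOn_rpow_mul_exp_neg_mul_rpow hq two_pos (by norm_num : (0 : ℝ) < 1 / 2)).congr_fun
      hcongr measurableSet_Ioi
  have h := integral_rpow_mul_exp_neg_mul_rpow two_pos hq (by norm_num : (0 : ℝ) < 1 / 2)
  rw [setIntegral_congr_fun measurableSet_Ioi hcongr] at h
  rw [← ofReal_integral_eq_lintegral_ofReal hint
    ((ae_restrict_mem measurableSet_Ioi).mono fun r hr ↦ chiDensity_nonneg n (le_of_lt hr)), h]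
  congr 1
  rw [chiMass, sub_add_cancel, Real.rpow_sub two_pos, one_div, Real.inv_rpow (by norm_num),
    neg_div, Real.rpow_neg (by norm_num), inv_inv, Real.rpow_one]
  ring

theorem map_radial (n : ℕ) :
    (radial n).map Subtype.val =
      (volume.restrict (Ioi 0)).withDensity fun r ↦ ENNReal.ofReal (chiDensity n r) := by
  have hm : Measurable (Subtype.val : Ioi (0 : ℝ) → ℝ) := measurable_subtype_coe
  rw [radial, Measure.volumeIoiPow, ← withDensity_mul _ (by fun_prop) (by fun_prop),
    ← map_comap_subtype_coe measurableSet_Ioi]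
  ext s hs
  rw [Measure.map_apply hm hs, withDensity_apply _ (hm hs), withDensity_apply _ hs,
    Measure.restrict_map hm hs, lintegral_map (by fun_prop) hm]
  refine lintegral_congr fun r ↦ ?_
  rw [Pi.mul_apply, chiDensity, ENNReal.ofReal_mul (pow_nonneg (le_of_lt r.2) _)]

theorem radial_univ {n : ℕ} (hn : 0 < n) : radial n univ = ENNReal.ofReal (chiMass n) := by
  rw [← lintegral_chiDensity hn, ← preimage_univ (f := (Subtype.val : Ioi (0 : ℝ) → ℝ)),
    ← Measure.map_apply measurable_subtype_coe MeasurableSet.univ, map_radial,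
    withDensity_apply _ MeasurableSet.univ, Measure.restrict_univ]

/-- On `(-π, π)` positivity of the sine forces `φ > 0`, and there the cosine is decreasing. The
condition `0 ≤ lam` inside the conjunction keeps the equivalence valid for negative `lam`, when the
interval is empty. -/
theorem polar_sector_iff {lam : ℝ} (hlam : lam < Real.pi / 2) {r φ : ℝ}
    (hr : 0 < r) (hφ : φ ∈ Ioo (-Real.pi) Real.pi) :
    (0 < r * Real.cos φ ∧ 0 < r * Real.sin φ ∧
      Real.cos lam * √((r * Real.cos φ) ^ 2 + (r * Real.sin φ) ^ 2) ≤ r * Real.cos φ ∧ 0 ≤ lam) ↔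
      φ ∈ Ioc 0 lam := by
  have hsqrt : √((r * Real.cos φ) ^ 2 + (r * Real.sin φ) ^ 2) = r := by
    rw [show (r * Real.cos φ) ^ 2 + (r * Real.sin φ) ^ 2 =
      r ^ 2 * (Real.sin φ ^ 2 + Real.cos φ ^ 2) by ring, Real.sin_sq_add_cos_sq, mul_one,
      Real.sqrt_sq hr.le]
  rw [hsqrt, mul_comm (Real.cos lam), mul_le_mul_iff_right₀ hr, mul_pos_iff_of_pos_left hr,
    mul_pos_iff_of_pos_left hr]
  constructor
  · rintro ⟨-, hs, hl, h0⟩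
    have h1 : 0 < φ := by
      by_contra! h
      exact absurd hs (Real.sin_nonpos_of_nonpos_of_neg_pi_le h hφ.1.le).not_gt
    refine ⟨h1, ?_⟩
    by_contra! h
    exact absurd hl (Real.cos_lt_cos_of_nonneg_of_le_pi h0 hφ.2.le h).not_ge
  · rintro ⟨h0, hl⟩
    have := Real.pi_pos
    exact ⟨Real.cos_pos_of_mem_Ioo ⟨by linarith, by linarith⟩, Real.sin_pos_of_mem_Ioo ⟨h0, hφ.2⟩,
      Real.cos_le_cos_of_nonneg_of_le_pi h0.le (by linarith) hl, by linarith⟩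

theorem lintegral_polar_sector {k l : ℕ} (hk : 0 < k) (hl : 0 < l) {lam : ℝ} (h0 : 0 ≤ lam)
    (hlam : lam < Real.pi / 2) :
    ∫⁻ p : ℝ × ℝ, {p : ℝ × ℝ | 0 < p.1 ∧ 0 < p.2 ∧
        Real.cos lam * √(p.1 ^ 2 + p.2 ^ 2) ≤ p.1 ∧ 0 ≤ lam}.indicator
        (fun p ↦ ENNReal.ofReal (chiDensity k p.1) * ENNReal.ofReal (chiDensity l p.2)) p =
      ENNReal.ofReal (chiMass (k + l) *
        ∫ φ in (0 : ℝ)..lam, Real.cos φ ^ (k - 1) * Real.sin φ ^ (l - 1)) := by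
  rw [← lintegral_comp_polarCoord_symm]
  have hpi := Real.pi_pos
  have hcs : ∀ φ ∈ Ioc 0 lam, 0 ≤ Real.cos φ ∧ 0 ≤ Real.sin φ := fun φ hφ ↦
    ⟨Real.cos_nonneg_of_mem_Icc ⟨by linarith [hφ.1], by linarith [hφ.2]⟩,
      Real.sin_nonneg_of_mem_Icc ⟨hφ.1.le, by linarith [hφ.2]⟩⟩
  have hstep : EqOn (fun p : ℝ × ℝ ↦ ENNReal.ofReal p.1 • {p : ℝ × ℝ | 0 < p.1 ∧ 0 < p.2 ∧
        Real.cos lam * √(p.1 ^ 2 + p.2 ^ 2) ≤ p.1 ∧ 0 ≤ lam}.indicator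
        (fun p ↦ ENNReal.ofReal (chiDensity k p.1) * ENNReal.ofReal (chiDensity l p.2))
        (polarCoord.symm p))
      ((univ ×ˢ Ioc 0 lam).indicator fun p ↦ ENNReal.ofReal (chiDensity (k + l) p.1) *
        ENNReal.ofReal (Real.cos p.2 ^ (k - 1) * Real.sin p.2 ^ (l - 1))) polarCoord.target := by
    rintro ⟨r, φ⟩ ⟨hr, hφ⟩
    simp only [mem_Ioi] at hr
    have hiff := polar_sector_iff hlam hr hφ
    simp only [polarCoord_symm_apply]
    by_cases h : φ ∈ Ioc 0 lam
    · rw [indicator_of_mem (by exact hiff.2 h), indicator_of_mem (by exact ⟨mem_univ _, h⟩)]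
      obtain ⟨hc, hs⟩ := hcs φ h
      rw [smul_eq_mul, ← ENNReal.ofReal_mul (chiDensity_nonneg _ (by positivity)),
        ← ENNReal.ofReal_mul hr.le, ← ENNReal.ofReal_mul (chiDensity_nonneg _ hr.le)]
      congr 1
      -- Successors remove the truncated subtractions. The Jacobian supplies one more factor `r`, so
      -- the powers of `r` combine to the exponent of the chi density with `k + l` degrees of
      -- freedom.
      obtain ⟨k, rfl⟩ := Nat.exists_eq_add_of_le' hk
      obtain ⟨l, rfl⟩ := Nat.exists_eq_add_of_le' hl
      have hexp : Real.exp (-r ^ 2 / 2) = Real.exp (-(r * Real.cos φ) ^ 2 / 2) *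
          Real.exp (-(r * Real.sin φ) ^ 2 / 2) := by
        rw [← Real.exp_add]
        congr 1
        linear_combination (r ^ 2 / 2) * Real.sin_sq_add_cos_sq φ
      simp only [chiDensity, Nat.add_sub_cancel, hexp, show k + 1 + (l + 1) - 1 = k + l + 1 by lia,
        mul_pow]
      ring
    · rw [indicator_of_notMem (by exact fun h' ↦ h (hiff.1 h')),
        indicator_of_notMem (by exact fun h' ↦ h h'.2), smul_zero]
  rw [setLIntegral_congr_fun polarCoord.open_target.measurableSet hstep,
    setLIntegral_indicator (MeasurableSet.univ.prod measurableSet_Ioc)]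
  have hset : (univ ×ˢ Ioc 0 lam) ∩ polarCoord.target = Ioi (0 : ℝ) ×ˢ Ioc 0 lam := by
    ext ⟨r, φ⟩
    simp only [polarCoord_target, mem_inter_iff, mem_prod, mem_univ, true_and, mem_Ioi, mem_Ioc,
      mem_Ioo]
    constructor
    · tauto
    · rintro ⟨hr, hφ⟩
      exact ⟨hφ, hr, by linarith, by linarith⟩
  rw [hset, Measure.volume_eq_prod, ← Measure.prod_restrict,
    lintegral_prod_mul (f := fun r ↦ ENNReal.ofReal (chiDensity (k + l) r))
      (g := fun φ ↦ ENNReal.ofReal (Real.cos φ ^ (k - 1) * Real.sin φ ^ (l - 1)))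
      (by fun_prop) (by fun_prop), lintegral_chiDensity (by lia),
    intervalIntegral.integral_of_le h0, ENNReal.ofReal_mul (chiMass_pos (by lia)).le]
  congr 1
  refine (ofReal_integral_eq_lintegral_ofReal ?_ ?_).symm
  · exact (Continuous.integrableOn_Icc (by fun_prop)).mono_set Ioc_subset_Icc_self
  · filter_upwards [ae_restrict_mem measurableSet_Ioc] with φ hφ
    obtain ⟨hc, hs⟩ := hcs φ hφ
    positivity

/-- The product `ω n * chiMass n` equals `(2π)^(n/2)`, which is multiplicative in the dimension. -/
theorem omega_mul_div (k l : ℕ) (hk : 0 < k) (hl : 0 < l) :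
    ω k * ω l / ω (k + l) = chiMass (k + l) / (chiMass k * chiMass l) := by
  have hG : ∀ n : ℕ, 0 < n → Real.Gamma ((n : ℝ) / 2) ≠ 0 := fun n hn ↦
    (Real.Gamma_pos_of_pos (by positivity)).ne'
  have h1 := hG k hk
  have h2 := hG l hl
  have h3 := hG (k + l) (by lia)
  simp only [ω, chiMass]
  push_cast at h3 ⊢
  rw [add_div, Real.rpow_add Real.pi_pos, Real.rpow_sub two_pos, Real.rpow_sub two_pos,
    Real.rpow_sub two_pos, Real.rpow_add two_pos, ← add_div, Real.rpow_one]
  have := Real.pi_pos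
  field_simp

/-- This is the source of `g_k`: the proportion of the joint law of two independent norms lying in a
planar sector. The total mass appears because `radial` is not normalised. -/
theorem radial_prod_sector {k l : ℕ} (hk : 0 < k) (hl : 0 < l) {lam : ℝ} (h0 : 0 ≤ lam)
    (hlam : lam < Real.pi / 2) :
    ((radial k).prod (radial l))
        {p | Real.cos lam * √(p.1.1 ^ 2 + p.2.1 ^ 2) ≤ p.1.1} =
      ENNReal.ofReal (g (k + l) k lam) * ((radial k).prod (radial l)) univ := by
  have hm : Measurable (Subtype.val : Ioi (0 : ℝ) → ℝ) := measurable_subtype_coe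
  set S := {p : ℝ × ℝ | 0 < p.1 ∧ 0 < p.2 ∧
        Real.cos lam * √(p.1 ^ 2 + p.2 ^ 2) ≤ p.1 ∧ 0 ≤ lam}
  have hS : MeasurableSet S := by measurability
  have hpre : {p : Ioi (0 : ℝ) × Ioi (0 : ℝ) |
      Real.cos lam * √(p.1.1 ^ 2 + p.2.1 ^ 2) ≤ p.1.1} = Prod.map Subtype.val Subtype.val ⁻¹' S := by
    ext ⟨r, s⟩
    have hr : 0 < r.1 := r.2
    have hs : 0 < s.1 := s.2
    simp [S, h0, hr, hs, -mem_Ioi]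
  have hval : ((radial k).prod (radial l))
        {p | Real.cos lam * √(p.1.1 ^ 2 + p.2.1 ^ 2) ≤ p.1.1} =
      ENNReal.ofReal (chiMass (k + l) *
        ∫ φ in (0 : ℝ)..lam, Real.cos φ ^ (k - 1) * Real.sin φ ^ (l - 1)) := by
    have : SFinite ((radial k).map Subtype.val) := by infer_instance
    rw [hpre, ← Measure.map_apply (hm.prodMap hm) hS, ← Measure.map_prod_map _ _ hm hm, map_radial,
      map_radial, prod_withDensity (by fun_prop) (by fun_prop), withDensity_apply _ hS,
      Measure.prod_restrict, Measure.restrict_restrict hS,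
      inter_eq_left.2 (show S ⊆ Ioi 0 ×ˢ Ioi 0 from fun p hp ↦ ⟨hp.1, hp.2.1⟩), ← lintegral_indicator hS,
      ← Measure.volume_eq_prod]
    exact lintegral_polar_sector hk hl h0 hlam
  rw [hval, ← univ_prod_univ, Measure.prod_prod, radial_univ hk, radial_univ hl,
    ← ENNReal.ofReal_mul (chiMass_pos hk).le,
    ← ENNReal.ofReal_mul' (mul_nonneg (chiMass_pos hk).le (chiMass_pos hl).le), g,
    if_neg (by lia), Nat.add_sub_cancel_left, omega_mul_div k l hk hl]
  congr 1
  have := chiMass_pos hk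
  have := chiMass_pos hl
  field_simp

end

/-! ### Independence of directions and angle for a subspace and its complement -/

section

open Metric Set

/-- Used with `α`, `γ` the directions and `β`, `δ` the radii: regrouping the four factors makes a
direction event and a radius event independent. -/
theorem prod_prod_apply_inter {α β γ δ : Type*} [MeasurableSpace α] [MeasurableSpace β]
    [MeasurableSpace γ] [MeasurableSpace δ] (μ₁ : Measure α) (ν₁ : Measure β) (μ₂ : Measure γ)
    (ν₂ : Measure δ) [SFinite μ₁] [SFinite ν₁] [SFinite μ₂] [SFinite ν₂] {A : Set (α × γ)}
    {R : Set (β × δ)} (hA : MeasurableSet A) (hR : MeasurableSet R) :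
    ((μ₁.prod ν₁).prod (μ₂.prod ν₂)) {p | (p.1.1, p.2.1) ∈ A ∧ (p.1.2, p.2.2) ∈ R} =
      μ₁.prod μ₂ A * ν₁.prod ν₂ R := by
  have hm : MeasurableSet {p : (α × β) × (γ × δ) | (p.1.1, p.2.1) ∈ A ∧ (p.1.2, p.2.2) ∈ R} :=
    ((by fun_prop : Measurable fun p : (α × β) × (γ × δ) ↦ (p.1.1, p.2.1)) hA).inter
      ((by fun_prop : Measurable fun p : (α × β) × (γ × δ) ↦ (p.1.2, p.2.2)) hR)
  rw [Measure.prod_apply hm, Measure.prod_apply hA, Measure.prod_apply hR,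
    ← lintegral_prod_mul (measurable_measure_prodMk_left hA).aemeasurable
      (measurable_measure_prodMk_left hR).aemeasurable]
  refine lintegral_congr fun p ↦ ?_
  rw [← Measure.prod_prod]
  rfl

section

variable {E : Type*} [NormedAddCommGroup E] [InnerProductSpace ℝ E] [FiniteDimensional ℝ E]
  [MeasurableSpace E] [BorelSpace E]

/-- Vectors of `L` see only the component of `t` in `L`. By Pythagoras, the functions for `L` and
`Lᗮ` multiply to the one for `E`. -/
theorem charFun_map_subtype (L : Submodule ℝ E) (t : E) :
    charFun ((stdGaussian L).map Subtype.val) t =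
      Complex.exp (-‖L.starProjection t‖ ^ 2 / 2) := by
  rw [charFun_apply, integral_map (by fun_prop) (by fun_prop)]
  have h : ∀ u : L, inner ℝ (u : E) t = inner ℝ u (L.orthogonalProjectionOnto t) := by
    intro u
    rw [Submodule.coe_inner, ← Submodule.starProjection_apply,
      ← Submodule.inner_starProjection_left_eq_right, Submodule.starProjection_mem_subspace_eq_self]
  simp_rw [h]
  rw [← charFun_apply, charFun_stdGaussian, Submodule.starProjection_apply, Submodule.coe_norm]

/-- The standard Gaussian measure is the product of the standard Gaussian measures on a subspace
and on its orthogonal complement. -/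
theorem map_add_prod_stdGaussian (L : Submodule ℝ E) :
    ((stdGaussian L).prod (stdGaussian Lᗮ)).map (fun p ↦ (p.1 : E) + (p.2 : E)) =
      stdGaussian E := by
  have hL : Measurable (Subtype.val : L → E) := measurable_subtype_coe
  have hL' : Measurable (Subtype.val : Lᗮ → E) := measurable_subtype_coe
  have : IsProbabilityMeasure ((stdGaussian L).map Subtype.val) :=
    Measure.isProbabilityMeasure_map hL.aemeasurable
  have : IsProbabilityMeasure ((stdGaussian Lᗮ).map Subtype.val) :=
    Measure.isProbabilityMeasure_map hL'.aemeasurable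
  have h : ((stdGaussian L).prod (stdGaussian Lᗮ)).map (fun p ↦ (p.1 : E) + (p.2 : E)) =
      (stdGaussian L).map Subtype.val ∗ (stdGaussian Lᗮ).map Subtype.val := by
    rw [Measure.conv, Measure.map_prod_map _ _ hL hL', Measure.map_map (by fun_prop) (by fun_prop)]
    rfl
  rw [h]
  refine Measure.ext_of_charFun (funext fun t ↦ ?_)
  rw [charFun_conv, charFun_map_subtype, charFun_map_subtype, charFun_stdGaussian,
    ← Complex.exp_add]
  congr 1
  have := congrArg (Complex.ofReal) (Submodule.norm_sq_eq_add_norm_sq_starProjection t L)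
  push_cast at this
  rw [this]
  ring

/-- For a biconic set `A`, the direction event `(P_L g, P_{Lᗮ} g) ∈ A` is independent of the
angle between `g` and `L`. -/
theorem stdGaussian_biconic_sector (L : Submodule ℝ E) (hk : 0 < Module.finrank ℝ L)
    (hl : 0 < Module.finrank ℝ Lᗮ) {A : Set (E × E)} (hA : MeasurableSet A)
    (hcone : ∀ x y : E, (x, y) ∈ A → ∀ a b : ℝ, 0 < a → 0 < b → (a • x, b • y) ∈ A)
    {lam : ℝ} (h0 : 0 ≤ lam) (hlam : lam < Real.pi / 2) :
    stdGaussian E {x | (L.starProjection x, Lᗮ.starProjection x) ∈ A ∧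
        Real.cos lam * ‖x‖ ≤ ‖L.starProjection x‖} =
      ENNReal.ofReal (g (Module.finrank ℝ E) (Module.finrank ℝ L) lam) *
        stdGaussian E {x | (L.starProjection x, Lᗮ.starProjection x) ∈ A} := by
  have : Nontrivial L := Module.finrank_pos_iff.1 hk
  have : Nontrivial Lᗮ := Module.finrank_pos_iff.1 hl
  obtain ⟨σ, hσ, hσL⟩ := exists_map_prod_radial_eq_stdGaussian L
  obtain ⟨τ, hτ, hτL⟩ := exists_map_prod_radial_eq_stdGaussian Lᗮ
  set k := Module.finrank ℝ L
  set l := Module.finrank ℝ Lᗮ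
  set Ψ : (sphere (0 : L) 1 × Ioi (0 : ℝ)) × (sphere (0 : Lᗮ) 1 × Ioi (0 : ℝ)) → E :=
    fun p ↦ p.1.2.1 • (p.1.1.1 : E) + p.2.2.1 • (p.2.1.1 : E)
  have hΨ : Measurable Ψ := by fun_prop
  have hγ : stdGaussian E = ((σ.prod (radial k)).prod (τ.prod (radial l))).map Ψ := by
    have hm1 : Measurable fun p : sphere (0 : L) 1 × Ioi (0 : ℝ) ↦ p.2.1 • p.1.1 := by fun_prop
    have hm2 : Measurable fun p : sphere (0 : Lᗮ) 1 × Ioi (0 : ℝ) ↦ p.2.1 • p.1.1 := by fun_prop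
    have : SFinite ((σ.prod (radial k)).map fun p ↦ p.2.1 • p.1.1) := by infer_instance
    have : SFinite ((τ.prod (radial l)).map fun p ↦ p.2.1 • p.1.1) := by infer_instance
    rw [← map_add_prod_stdGaussian L, ← hσL, ← hτL, Measure.map_prod_map _ _ hm1 hm2,
      Measure.map_map (by fun_prop) (by fun_prop)]
    rfl
  have hproj : ∀ p, L.starProjection (Ψ p) = p.1.2.1 • (p.1.1.1 : E) ∧
      Lᗮ.starProjection (Ψ p) = p.2.2.1 • (p.2.1.1 : E) := by
    intro p
    have h1 : p.1.2.1 • (p.1.1.1 : E) ∈ L := L.smul_mem _ p.1.1.1.2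
    have h2 : p.2.2.1 • (p.2.1.1 : E) ∈ Lᗮ := Lᗮ.smul_mem _ p.2.1.1.2
    have h3 : L.starProjection (Ψ p) = p.1.2.1 • (p.1.1.1 : E) :=
      Submodule.eq_starProjection_of_mem_orthogonal' h1 h2 rfl
    refine ⟨h3, ?_⟩
    rw [Submodule.starProjection_orthogonal_val, h3]
    simp [Ψ]
  have hnorm1 : ∀ p : sphere (0 : L) 1 × Ioi (0 : ℝ), ‖p.2.1 • (p.1.1 : E)‖ = p.2.1 := by
    intro p
    have h1 : ‖(p.1.1 : E)‖ = 1 := by simp [← Submodule.coe_norm]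
    rw [norm_smul, h1, mul_one, Real.norm_of_nonneg (le_of_lt p.2.2)]
  have hnorm2 : ∀ p : sphere (0 : Lᗮ) 1 × Ioi (0 : ℝ), ‖p.2.1 • (p.1.1 : E)‖ = p.2.1 := by
    intro p
    have h1 : ‖(p.1.1 : E)‖ = 1 := by simp [← Submodule.coe_norm]
    rw [norm_smul, h1, mul_one, Real.norm_of_nonneg (le_of_lt p.2.2)]
  have hnorm : ∀ p, ‖Ψ p‖ = √(p.1.2.1 ^ 2 + p.2.2.1 ^ 2) := by
    intro p
    rw [← Real.sqrt_sq (norm_nonneg (Ψ p)),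
      Submodule.norm_sq_eq_add_norm_sq_starProjection (Ψ p) L, (hproj p).1, (hproj p).2, hnorm1,
      hnorm2]
  -- Biconicity, applied with the radii and with their inverses, removes the radii from the
  -- condition.
  have hcone' : ∀ p, ((L.starProjection (Ψ p), Lᗮ.starProjection (Ψ p)) ∈ A ↔
      ((p.1.1.1 : E), (p.2.1.1 : E)) ∈ A) := by
    intro p
    have hr : 0 < p.1.2.1 := p.1.2.2
    have hs : 0 < p.2.2.1 := p.2.2.2
    rw [(hproj p).1, (hproj p).2]
    refine ⟨fun h ↦ ?_, fun h ↦ hcone _ _ h _ _ hr hs⟩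
    have := hcone _ _ h _ _ (inv_pos.2 hr) (inv_pos.2 hs)
    rwa [inv_smul_smul₀ hr.ne', inv_smul_smul₀ hs.ne'] at this
  set A' : Set (sphere (0 : L) 1 × sphere (0 : Lᗮ) 1) :=
    (fun p ↦ ((p.1.1 : E), (p.2.1 : E))) ⁻¹' A
  have hA' : MeasurableSet A' :=
    (by fun_prop : Measurable fun p : sphere (0 : L) 1 × sphere (0 : Lᗮ) 1 ↦
      ((p.1.1 : E), (p.2.1 : E))) hA
  set R : Set (Ioi (0 : ℝ) × Ioi (0 : ℝ)) :=
    {p | Real.cos lam * √(p.1.1 ^ 2 + p.2.1 ^ 2) ≤ p.1.1}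
  have hR : MeasurableSet R := measurableSet_le (by fun_prop) (by fun_prop)
  have hmA : MeasurableSet {x | (L.starProjection x, Lᗮ.starProjection x) ∈ A} :=
    (by fun_prop : Measurable fun x ↦ (L.starProjection x, Lᗮ.starProjection x)) hA
  have hmR : MeasurableSet {x | Real.cos lam * ‖x‖ ≤ ‖L.starProjection x‖} :=
    measurableSet_le (by fun_prop) (by fun_prop)
  have e1 : Ψ ⁻¹' {x | (L.starProjection x, Lᗮ.starProjection x) ∈ A ∧
      Real.cos lam * ‖x‖ ≤ ‖L.starProjection x‖} =
      {p | (p.1.1, p.2.1) ∈ A' ∧ (p.1.2, p.2.2) ∈ R} := by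
    ext p
    simp only [mem_preimage, mem_ofPred_eq, hcone', hnorm, A', R]
    rw [(hproj p).1, hnorm1]
  have e2 : Ψ ⁻¹' {x | (L.starProjection x, Lᗮ.starProjection x) ∈ A} =
      {p | (p.1.1, p.2.1) ∈ A' ∧ (p.1.2, p.2.2) ∈ univ} := by
    ext p
    simp only [mem_preimage, mem_ofPred_eq, hcone', A', mem_univ, and_true]
  have hkl : Module.finrank ℝ E = k + l := (L.finrank_add_finrank_orthogonal).symm
  have hmAR : MeasurableSet {x | (L.starProjection x, Lᗮ.starProjection x) ∈ A ∧
      Real.cos lam * ‖x‖ ≤ ‖L.starProjection x‖} := hmA.inter hmR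
  rw [hγ, Measure.map_apply hΨ hmAR, Measure.map_apply hΨ hmA, e1, e2, prod_prod_apply_inter _ _ _ _ hA' hR, prod_prod_apply_inter _ _ _ _ hA' .univ,
    radial_prod_sector hk hl h0 hlam, hkl]
  ring

end

end

/-! ### Metric projection and faces of polyhedral cones -/

section

open Set Filter Topology

section Projection

variable {d : ℕ} {C : PointedCone ℝ (Euc d)}

theorem isNearest_proj (hC : IsClosed (C : Set (Euc d))) (x : Euc d) : IsNearest C x (proj C x) :=
  Classical.epsilon_spec (existsUnique_isNearest C hC x).exists

theorem inner_sub_proj (hC : IsClosed (C : Set (Euc d))) (x : Euc d) {w : Euc d} (hw : w ∈ C) :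
    inner ℝ (x - proj C x) (w - proj C x) ≤ 0 := by
  have hq := isNearest_proj hC x
  have : Nonempty (C : Set (Euc d)) := ⟨⟨0, C.zero_mem⟩⟩
  have hbdd : BddBelow (range fun w : (C : Set (Euc d)) => ‖x - w‖) :=
    ⟨0, by rintro _ ⟨w, rfl⟩; exact norm_nonneg _⟩
  refine (norm_eq_iInf_iff_real_inner_le_zero C.convex hq.1).1 (le_antisymm ?_ ?_) w hw
  · exact le_ciInf fun w => hq.2 w w.2
  · exact ciInf_le hbdd (⟨proj C x, hq.1⟩ : (C : Set (Euc d)))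

theorem proj_mem (hC : IsClosed (C : Set (Euc d))) (x : Euc d) : proj C x ∈ C :=
  (isNearest_proj hC x).1

theorem inner_sub_proj_self (hC : IsClosed (C : Set (Euc d))) (x : Euc d) :
    inner ℝ (x - proj C x) (proj C x) = 0 := by
  have h1 := inner_sub_proj hC x C.zero_mem
  -- Testing the variational inequality at `0` and at twice the projection gives both signs.
  have h2 := inner_sub_proj hC x (C.add_mem (proj_mem hC x) (proj_mem hC x))
  rw [zero_sub, inner_neg_right] at h1
  rw [add_sub_cancel_right] at h2
  linarith

theorem sub_proj_mem_polar (hC : IsClosed (C : Set (Euc d))) (x : Euc d) :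
    x - proj C x ∈ polar C := by
  intro y hy
  have h := inner_sub_proj hC x hy
  rwa [inner_sub_right, inner_sub_proj_self hC, sub_zero] at h

theorem proj_eq (hC : IsClosed (C : Set (Euc d))) {x p : Euc d} (hp : p ∈ C)
    (horth : inner ℝ (x - p) p = 0) (hpol : x - p ∈ polar C) : proj C x = p := by
  refine (existsUnique_isNearest C hC x).unique (isNearest_proj hC x) ⟨hp, fun y hy ↦ ?_⟩
  have h : inner ℝ (x - p) (p - y) ≥ (0 : ℝ) := by
    rw [inner_sub_right, horth]
    linarith [hpol y hy]
  have h2 : ‖x - y‖ ^ 2 = ‖x - p‖ ^ 2 + 2 * inner ℝ (x - p) (p - y) + ‖p - y‖ ^ 2 := by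
    rw [← norm_add_sq_real, sub_add_sub_cancel]
  refine le_of_sq_le_sq ?_ (norm_nonneg _)
  nlinarith [sq_nonneg ‖p - y‖]

/-- Moreau's decomposition. -/
theorem proj_polar (hC : IsClosed (C : Set (Euc d))) (x : Euc d) :
    proj (polar C) x = x - proj C x := by
  refine proj_eq (isClosed_polar C) (sub_proj_mem_polar hC x) ?_ ?_
  · rw [sub_sub_cancel, real_inner_comm, inner_sub_proj_self hC]
  · rw [sub_sub_cancel]
    intro y hy
    rw [real_inner_comm]
    exact hy _ (proj_mem hC x)

end Projection

section Faces

variable {d : ℕ}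

open Classical in
/-- The normals in `s` whose constraint is active at `p`. -/
noncomputable def active (s : Finset (Euc d)) (p : Euc d) : Finset (Euc d) :=
  s.filter fun y ↦ inner ℝ p y = 0

theorem mem_active {s : Finset (Euc d)} {p y : Euc d} :
    y ∈ active s p ↔ y ∈ s ∧ inner ℝ p y = 0 := by
  classical
  simp [active]

theorem active_smul (s : Finset (Euc d)) (p : Euc d) {a : ℝ} (ha : 0 < a) :
    active s (a • p) = active s p := by
  ext y
  simp [mem_active, real_inner_smul_left, ha.ne']

/-- The subspace orthogonal to all vectors of `I`. -/
noncomputable def annihilator (I : Finset (Euc d)) : Submodule ℝ (Euc d) where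
  carrier := {x | ∀ y ∈ I, inner ℝ x y = 0}
  zero_mem' := by simp
  add_mem' := by
    intro a b ha hb y hy
    rw [inner_add_left, ha y hy, hb y hy, add_zero]
  smul_mem' := by
    intro c x hx y hy
    rw [real_inner_smul_left, hx y hy, mul_zero]

theorem self_mem_annihilator_active (s : Finset (Euc d)) (p : Euc d) :
    p ∈ annihilator (active s p) := fun _ hy ↦ (mem_active.1 hy).2

variable {C : PointedCone ℝ (Euc d)} {s : Finset (Euc d)}

/-- Active constraints stay equalities along `z`; the finitely many others are strict at `p` and
survive a small move. -/
theorem eventually_add_smul_mem (hs : ∀ x : Euc d, x ∈ C ↔ ∀ y ∈ s, inner ℝ x y ≤ 0)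
    {p z : Euc d} (hp : p ∈ C) (hz : z ∈ annihilator (active s p)) :
    ∀ᶠ t in 𝓝[>] (0 : ℝ), p + t • z ∈ C := by
  have h : ∀ᶠ t in 𝓝 (0 : ℝ), ∀ y ∈ s, inner ℝ (p + t • z) y ≤ 0 := by
    refine (Filter.eventually_all_finset s).2 fun y hy ↦ ?_
    by_cases hact : inner ℝ p y = 0
    · refine .of_forall fun t ↦ ?_
      rw [inner_add_left, real_inner_smul_left, hact, hz y (mem_active.2 ⟨hy, hact⟩)]
      simp
    · have hlt : inner ℝ p y < 0 := lt_of_le_of_ne ((hs p).1 hp y hy) hact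
      have hc : Tendsto (fun t : ℝ ↦ inner ℝ (p + t • z) y) (𝓝 0) (𝓝 (inner ℝ p y)) := by
        have : Continuous fun t : ℝ ↦ inner ℝ (p + t • z) y := by fun_prop
        simpa using this.tendsto 0
      exact (hc.eventually (gt_mem_nhds hlt)).mono fun t ht ↦ ht.le
  exact (h.filter_mono nhdsWithin_le_nhds).mono fun t ht ↦ (hs _).2 ht

theorem exists_add_sub_smul_mem (hs : ∀ x : Euc d, x ∈ C ↔ ∀ y ∈ s, inner ℝ x y ≤ 0)
    {p z : Euc d} (hp : p ∈ C) (hz : z ∈ annihilator (active s p)) :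
    ∃ t : ℝ, 0 < t ∧ p + t • z ∈ C ∧ p - t • z ∈ C := by
  have h1 := eventually_add_smul_mem hs hp hz
  have h2 := eventually_add_smul_mem hs hp (neg_mem hz)
  obtain ⟨t, ⟨ht1, ht2⟩, ht⟩ := ((h1.and h2).and self_mem_nhdsWithin).exists
  refine ⟨t, ht, ht1, ?_⟩
  rwa [smul_neg, ← sub_eq_add_neg] at ht2

theorem exists_sub_smul_mem_of_mem_intrinsicInterior {F : Set (Euc d)} {p z : Euc d}
    (hp : p ∈ intrinsicInterior ℝ F) (hz : z ∈ F) : ∃ t : ℝ, 0 < t ∧ p + t • (p - z) ∈ F := by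
  obtain ⟨q, hq, rfl⟩ := mem_intrinsicInterior.1 hp
  have hza : z ∈ affineSpan ℝ F := subset_affineSpan ℝ F hz
  -- The segment from `z` is prolonged beyond `q` inside the affine hull, where `q` is an interior
  -- point of `F`.
  have hline : ∀ t : ℝ, (q : Euc d) + t • ((q : Euc d) - z) ∈ affineSpan ℝ F := by
    intro t
    have h := AffineMap.lineMap_mem (k := ℝ) (-t) q.2 hza
    rw [AffineMap.lineMap_apply_module'] at h
    convert h using 1
    module
  have hc : Continuous fun t : ℝ ↦
      (⟨(q : Euc d) + t • ((q : Euc d) - z), hline t⟩ : affineSpan ℝ F) :=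
    Continuous.subtype_mk (by fun_prop) _
  have h0 : Tendsto (fun t : ℝ ↦
      (⟨(q : Euc d) + t • ((q : Euc d) - z), hline t⟩ : affineSpan ℝ F)) (𝓝[>] 0) (𝓝 q) := by
    have := (hc.tendsto 0).mono_left (nhdsWithin_le_nhds (s := Ioi 0))
    convert this
    simp
  obtain ⟨t, ht, htpos⟩ :=
    ((h0.eventually (mem_interior_iff_mem_nhds.1 hq)).and self_mem_nhdsWithin).exists
  exact ⟨t, htpos, ht⟩

theorem span_face_eq_annihilator (hs : ∀ x : Euc d, x ∈ C ↔ ∀ y ∈ s, inner ℝ x y ≤ 0)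
    {F : PointedCone ℝ (Euc d)} (hF : F.IsFaceOf C) {p : Euc d}
    (hp : p ∈ intrinsicInterior ℝ (F : Set (Euc d))) :
    Submodule.span ℝ (F : Set (Euc d)) = annihilator (active s p) := by
  have hpF : p ∈ F := intrinsicInterior_subset hp
  refine le_antisymm (Submodule.span_le.2 fun z hz y hy ↦ ?_) fun z hz ↦ ?_
  -- A constraint active at `p` is nonpositive at `z` and also at a point beyond `p` on the line
  -- from `z`, so it vanishes at `z`.
  · obtain ⟨t, ht, htF⟩ := exists_sub_smul_mem_of_mem_intrinsicInterior hp hz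
    obtain ⟨hys, hpy⟩ := mem_active.1 hy
    have h1 := (hs _).1 (hF.le htF) y hys
    have h2 := (hs _).1 (hF.le hz) y hys
    rw [inner_add_left, real_inner_smul_left, inner_sub_left, hpy] at h1
    nlinarith
  · obtain ⟨t, ht, h1, h2⟩ := exists_add_sub_smul_mem hs (hF.le hpF) hz
    -- The points `p ± t z` of `C` have midpoint `p` in the face, so they belong to the face.
    have hmem : p + t • z ∈ F := by
      refine hF.mem_of_smul_add_mem h1 h2 one_pos ?_
      have : (1 : ℝ) • (p + t • z) + (p - t • z) = p + p := by module
      rw [this]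
      exact F.add_mem hpF hpF
    have hz' : z = t⁻¹ • ((p + t • z) - p) := by
      rw [add_sub_cancel_left, inv_smul_smul₀ ht.ne']
    rw [hz']
    exact Submodule.smul_mem _ _
      (Submodule.sub_mem _ (Submodule.subset_span hmem) (Submodule.subset_span hpF))

/-- The face of `C` on which all the constraints in `I` are active. -/
noncomputable def faceOf (C : PointedCone ℝ (Euc d)) (I : Finset (Euc d)) :
    PointedCone ℝ (Euc d) :=
  C ⊓ PointedCone.ofSubmodule (annihilator I)

theorem mem_faceOf {I : Finset (Euc d)} {x : Euc d} :
    x ∈ faceOf C I ↔ x ∈ C ∧ x ∈ annihilator I := Iff.rfl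

theorem faceOf_isFaceOf (hs : ∀ x : Euc d, x ∈ C ↔ ∀ y ∈ s, inner ℝ x y ≤ 0)
    {I : Finset (Euc d)} (hI : I ⊆ s) : (faceOf C I).IsFaceOf C where
  le := inf_le_left
  mem_of_smul_add_mem := by
    intro x y a hx hy ha hxy
    refine mem_faceOf.2 ⟨hx, fun w hw ↦ ?_⟩
    have h1 := (hs x).1 hx w (hI hw)
    have h2 := (hs y).1 hy w (hI hw)
    have h3 := (mem_faceOf.1 hxy).2 w hw
    rw [inner_add_left, real_inner_smul_left] at h3
    nlinarith

theorem mem_intrinsicInterior_faceOf_active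
    (hs : ∀ x : Euc d, x ∈ C ↔ ∀ y ∈ s, inner ℝ x y ≤ 0) {p : Euc d} (hp : p ∈ C) :
    p ∈ intrinsicInterior ℝ (faceOf C (active s p) : Set (Euc d)) := by
  have hpF : p ∈ faceOf C (active s p) := mem_faceOf.2 ⟨hp, self_mem_annihilator_active s p⟩
  have hspan : ∀ q ∈ affineSpan ℝ (faceOf C (active s p) : Set (Euc d)),
      q ∈ annihilator (active s p) := by
    have : affineSpan ℝ (faceOf C (active s p) : Set (Euc d)) ≤
        (annihilator (active s p)).toAffineSubspace :=
      affineSpan_le.2 fun x hx ↦ (mem_faceOf.1 hx).2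
    exact fun q hq ↦ this hq
  refine mem_intrinsicInterior.2 ⟨⟨p, subset_affineSpan ℝ _ hpF⟩, ?_, rfl⟩
  rw [mem_interior_iff_mem_nhds]
  have hU : ∀ᶠ q in 𝓝 p, ∀ y ∈ s, y ∉ active s p → inner ℝ q y < 0 := by
    refine (Filter.eventually_all_finset s).2 fun y hy ↦ ?_
    by_cases hact : y ∈ active s p
    · exact .of_forall fun q h ↦ absurd hact h
    · have hlt : inner ℝ p y < 0 := lt_of_le_of_ne ((hs p).1 hp y hy)
        fun h ↦ hact (mem_active.2 ⟨hy, h⟩)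
      have hc : Continuous fun q : Euc d ↦ inner ℝ q y := by fun_prop
      exact ((hc.tendsto p).eventually (gt_mem_nhds hlt)).mono fun q hq _ ↦ hq
  filter_upwards [continuous_subtype_val.continuousAt.eventually hU] with q hq
  have hqa := hspan q q.2
  refine mem_faceOf.2 ⟨(hs _).2 fun y hy ↦ ?_, hqa⟩
  by_cases hact : y ∈ active s p
  · exact (hqa y hact).le
  · exact (hq y hy hact).le

/-- A point of a polyhedral cone is in the `k`-skeleton iff the subspace cut out by its active
constraints has dimension `k`. -/
theorem mem_skel_iff (hs : ∀ x : Euc d, x ∈ C ↔ ∀ y ∈ s, inner ℝ x y ≤ 0) {p : Euc d}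
    (hp : p ∈ C) {k : ℕ} :
    p ∈ skel k C ↔ Module.finrank ℝ (annihilator (active s p)) = k := by
  constructor
  · rintro ⟨F, hF, hk, hpF⟩
    rw [← hk, dim, span_face_eq_annihilator hs hF hpF]
  · rintro rfl
    have hF := faceOf_isFaceOf hs (fun y hy ↦ (mem_active.1 hy).1 : active s p ⊆ s)
    have hpF := mem_intrinsicInterior_faceOf_active hs hp
    exact ⟨_, hF, by rw [dim, span_face_eq_annihilator hs hF hpF], hpF⟩

/-- From the projection one can move within `C` in both directions `±z`. The residual is polar to
`C` and orthogonal to the projection, so its product with `z` has both signs. -/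
theorem sub_proj_mem_annihilator_orthogonal
    (hs : ∀ x : Euc d, x ∈ C ↔ ∀ y ∈ s, inner ℝ x y ≤ 0) (hC : IsClosed (C : Set (Euc d)))
    (x : Euc d) : x - proj C x ∈ (annihilator (active s (proj C x)))ᗮ := by
  rw [Submodule.mem_orthogonal']
  intro z hz
  obtain ⟨t, ht, h1, h2⟩ := exists_add_sub_smul_mem hs (proj_mem hC x) hz
  have h1 := sub_proj_mem_polar hC x _ h1
  have h2 := sub_proj_mem_polar hC x _ h2
  rw [inner_add_right, inner_smul_right, inner_sub_proj_self hC] at h1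
  rw [inner_sub_right, inner_smul_right, inner_sub_proj_self hC] at h2
  nlinarith

theorem proj_eq_starProjection (hs : ∀ x : Euc d, x ∈ C ↔ ∀ y ∈ s, inner ℝ x y ≤ 0)
    (hC : IsClosed (C : Set (Euc d))) (x : Euc d) :
    (annihilator (active s (proj C x))).starProjection x = proj C x :=
  Submodule.eq_starProjection_of_mem_orthogonal (self_mem_annihilator_active s _)
    (sub_proj_mem_annihilator_orthogonal hs hC x)

/-- The points projected to the relative interior of a given face form a product set with respect
to the decomposition into the span of the face and its orthogonal complement. -/
theorem active_proj_eq_iff (hs : ∀ x : Euc d, x ∈ C ↔ ∀ y ∈ s, inner ℝ x y ≤ 0)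
    (hC : IsClosed (C : Set (Euc d))) (x : Euc d) (I : Finset (Euc d)) :
    active s (proj C x) = I ↔
      ((annihilator I).starProjection x ∈ C ∧ active s ((annihilator I).starProjection x) = I ∧
        (annihilator I)ᗮ.starProjection x ∈ polar C) := by
  constructor
  · rintro rfl
    rw [Submodule.starProjection_orthogonal_val, proj_eq_starProjection hs hC]
    exact ⟨proj_mem hC x, rfl, sub_proj_mem_polar hC x⟩
  · rintro ⟨h1, h2, h3⟩
    rw [Submodule.starProjection_orthogonal_val] at h3
    rwa [proj_eq hC h1 (Submodule.starProjection_inner_eq_zero _ _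
      (Submodule.starProjection_apply_mem _ _)) h3]

end Faces

end

/-! ### Contribution of each face and summation -/

section

open Set

theorem stdGaussian_singleton {E : Type*} [NormedAddCommGroup E] [InnerProductSpace ℝ E]
    [FiniteDimensional ℝ E] [MeasurableSpace E] [BorelSpace E] [Nontrivial E] (x : E) :
    stdGaussian E {x} = 0 := by
  obtain ⟨c, -, h⟩ := stdGaussian_eq_withDensity E
  rw [h, Measure.smul_apply, withDensity_absolutelyContinuous _ _ (measure_singleton x),
    smul_zero]

theorem g_nonneg {k l : ℕ} (hk : 0 < k) (hl : 0 < l) {lam : ℝ} (h0 : 0 ≤ lam)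
    (hlam : lam < Real.pi / 2) : 0 ≤ g (k + l) k lam := by
  rw [g, if_neg (by lia), Nat.add_sub_cancel_left, omega_mul_div k l hk hl]
  have := chiMass_pos hk
  have := chiMass_pos hl
  have := chiMass_pos (Nat.add_pos_left hk l)
  refine mul_nonneg (by positivity) (intervalIntegral.integral_nonneg h0 fun φ hφ ↦ ?_)
  have hc : 0 ≤ Real.cos φ :=
    Real.cos_nonneg_of_mem_Icc ⟨by linarith [hφ.1, Real.pi_pos], by linarith [hφ.2]⟩
  have hs : 0 ≤ Real.sin φ :=
    Real.sin_nonneg_of_mem_Icc ⟨hφ.1, by linarith [hφ.2, Real.pi_pos]⟩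
  positivity

variable {d : ℕ} {C : PointedCone ℝ (Euc d)} {s : Finset (Euc d)}

theorem measurableSet_active (s I : Finset (Euc d)) : MeasurableSet {u | active s u = I} := by
  by_cases hI : I ⊆ s
  · have : {u | active s u = I} =
        ⋂ y ∈ s, {u : Euc d | inner ℝ u y = 0 ↔ y ∈ I} := by
      ext u
      simp only [mem_ofPred_eq, mem_iInter, Finset.ext_iff, mem_active]
      refine ⟨fun h y hy ↦ ⟨fun h' ↦ (h y).1 ⟨hy, h'⟩, fun h' ↦ ((h y).2 h').2⟩,
        fun h y ↦ ⟨fun h' ↦ (h y h'.1).1 h'.2, fun h' ↦ ⟨hI h', (h y (hI h')).2 h'⟩⟩⟩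
    rw [this]
    refine Finset.measurableSet_biInter s fun y _ ↦ ?_
    have hm : MeasurableSet {u : Euc d | inner ℝ u y = 0} :=
      measurableSet_eq_fun (by fun_prop) measurable_const
    by_cases hy : y ∈ I
    · simpa [hy] using hm
    · simp only [hy, iff_false]
      exact hm.compl
  · convert MeasurableSet.empty
    rw [eq_empty_iff_forall_notMem]
    rintro u rfl
    exact hI fun y hy ↦ (mem_active.1 hy).1

/-- For fixed `I` the event involves only linear projections, so measurability of `proj` itself is
not needed. -/
theorem measurableSet_active_proj (hs : ∀ x : Euc d, x ∈ C ↔ ∀ y ∈ s, inner ℝ x y ≤ 0)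
    (hC : IsClosed (C : Set (Euc d))) (I : Finset (Euc d)) :
    MeasurableSet {x | active s (proj C x) = I} := by
  simp_rw [active_proj_eq_iff hs hC]
  exact ((by fun_prop : Measurable (annihilator I).starProjection) hC.measurableSet).inter
    (((by fun_prop : Measurable (annihilator I).starProjection) (measurableSet_active s I)).inter
      ((by fun_prop : Measurable (annihilator I)ᗮ.starProjection)
        (isClosed_polar C).measurableSet))

/-- The biconic part of the event that a given set of constraints is active at the projection. -/
def activeEvent (C : PointedCone ℝ (Euc d)) (s I : Finset (Euc d)) (η : Set (Euc d × Euc d)) :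
    Set (Euc d × Euc d) :=
  {p | (p.1 ∈ C ∧ active s p.1 = I ∧ p.2 ∈ polar C) ∧ p ∈ η}

theorem measurableSet_activeEvent (hC : IsClosed (C : Set (Euc d))) (I : Finset (Euc d))
    {η : Set (Euc d × Euc d)} (hη : MeasurableSet η) :
    MeasurableSet (activeEvent C s I η) :=
  ((measurable_fst hC.measurableSet).inter ((measurable_fst (measurableSet_active s I)).inter
    (measurable_snd (isClosed_polar C).measurableSet))).inter hη

theorem smul_mem_activeEvent {I : Finset (Euc d)} {η : Set (Euc d × Euc d)} (hη : IsBiconic η)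
    (x y : Euc d) (h : (x, y) ∈ activeEvent C s I η) (a b : ℝ) (ha : 0 < a) (hb : 0 < b) :
    (a • x, b • y) ∈ activeEvent C s I η :=
  ⟨⟨PointedCone.smul_mem C ha.le h.1.1, (active_smul s x ha).trans h.1.2.1,
    PointedCone.smul_mem (polar C) hb.le h.1.2.2⟩, hη.2 x y h.2 a b ha hb⟩

theorem mem_activeEvent_iff (hs : ∀ x : Euc d, x ∈ C ↔ ∀ y ∈ s, inner ℝ x y ≤ 0)
    (hC : IsClosed (C : Set (Euc d))) (I : Finset (Euc d)) (η : Set (Euc d × Euc d)) (x : Euc d) :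
    ((annihilator I).starProjection x, (annihilator I)ᗮ.starProjection x) ∈ activeEvent C s I η ↔
      active s (proj C x) = I ∧ (proj C x, proj (polar C) x) ∈ η := by
  rw [activeEvent, mem_ofPred_eq, ← active_proj_eq_iff hs hC]
  refine and_congr_right ?_
  rintro rfl
  rw [Submodule.starProjection_orthogonal_val, proj_eq_starProjection hs hC, proj_polar hC]

theorem angDist_le_iff (C : PointedCone ℝ (Euc d)) {x : Euc d} (hx : x ≠ 0)
    (hle : ‖proj C x‖ ≤ ‖x‖) {lam : ℝ} (h0 : 0 ≤ lam) (hlam : lam < Real.pi / 2) :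
    angDist x C ≤ lam ↔ Real.cos lam * ‖x‖ ≤ ‖proj C x‖ := by
  have hpos : 0 < ‖x‖ := norm_pos_iff.2 hx
  have hpi := Real.pi_pos
  have h1 : ‖proj C x‖ / ‖x‖ ≤ 1 := (div_le_one hpos).2 hle
  have h2 : (-1 : ℝ) ≤ ‖proj C x‖ / ‖x‖ := by
    have : 0 ≤ ‖proj C x‖ / ‖x‖ := by positivity
    linarith
  rw [angDist, if_neg hx, ← le_div_iff₀ hpos]
  constructor
  · intro h
    rw [← Real.cos_arccos h2 h1]
    exact Real.cos_le_cos_of_nonneg_of_le_pi (Real.arccos_nonneg _) (by linarith) h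
  · intro h
    rw [← Real.arccos_cos h0 (by linarith)]
    exact Real.arccos_le_arccos h

theorem norm_proj_le (hC : IsClosed (C : Set (Euc d))) (x : Euc d) : ‖proj C x‖ ≤ ‖x‖ := by
  have h := norm_add_sq_real (x - proj C x) (proj C x)
  rw [sub_add_cancel, inner_sub_proj_self hC] at h
  refine le_of_sq_le_sq ?_ (norm_nonneg _)
  nlinarith [sq_nonneg ‖x - proj C x‖]

/-- The contribution of a single face of the cone to the measure of the angular parallel set. -/
theorem stdGaussian_angParallel_inter_active (hd : 0 < d)
    (hs : ∀ x : Euc d, x ∈ C ↔ ∀ y ∈ s, inner ℝ x y ≤ 0) (hC : IsClosed (C : Set (Euc d)))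
    {η : Set (Euc d × Euc d)} (hη : IsBiconic η) {lam : ℝ} (h0 : 0 ≤ lam)
    (hlam : lam < Real.pi / 2) (I : Finset (Euc d)) :
    (stdGaussian (Euc d)).real {x | active s (proj C x) = I ∧ x ∈ angParallel lam C η} =
      (if Module.finrank ℝ (annihilator I) = 0 then 0
        else g d (Module.finrank ℝ (annihilator I)) lam) *
      (stdGaussian (Euc d)).real
        {x | active s (proj C x) = I ∧ (proj C x, proj (polar C) x) ∈ η} := by
  have : Nonempty (Fin d) := ⟨⟨0, hd⟩⟩
  have hnt : Nontrivial (Euc d) := inferInstance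
  set L := annihilator I
  have hEvent : {x | active s (proj C x) = I ∧ (proj C x, proj (polar C) x) ∈ η} =
      {x | (L.starProjection x, Lᗮ.starProjection x) ∈ activeEvent C s I η} := by
    ext x
    exact (mem_activeEvent_iff hs hC I η x).symm
  have hpar : {x | active s (proj C x) = I ∧ x ∈ angParallel lam C η} =ᵐ[stdGaussian (Euc d)]
      {x | (L.starProjection x, Lᗮ.starProjection x) ∈ activeEvent C s I η ∧
        Real.cos lam * ‖x‖ ≤ ‖L.starProjection x‖} := by
    -- At the origin the angular distance is `π/2` by convention, while the cosine inequality holds;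
    -- the two sets agree only up to this null point.
    have hne : ∀ᵐ x ∂stdGaussian (Euc d), x ≠ 0 := by
      rw [ae_iff]
      simpa using stdGaussian_singleton (0 : Euc d)
    refine Filter.eventuallyEq_set.2 (hne.mono fun x hx ↦ ?_)
    simp only [mem_ofPred_eq]
    rw [mem_activeEvent_iff hs hC, angParallel, mem_ofPred_eq,
      angDist_le_iff C hx (norm_proj_le hC x) h0 hlam, and_assoc]
    refine and_congr_right ?_
    rintro rfl
    rw [proj_eq_starProjection hs hC, and_comm]
  have hfin : Module.finrank ℝ L + Module.finrank ℝ Lᗮ = d := by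
    rw [L.finrank_add_finrank_orthogonal, finrank_euclideanSpace_fin]
  rw [measureReal_congr hpar, hEvent]
  rcases Nat.eq_zero_or_pos (Module.finrank ℝ L) with hk | hk
  -- If `L` is trivial, then `cos λ > 0` leaves only the origin in the sector.
  · rw [if_pos hk, zero_mul]
    have hbot : L = ⊥ := Submodule.finrank_eq_zero.1 hk
    have hcos : 0 < Real.cos lam :=
      Real.cos_pos_of_mem_Ioo ⟨by linarith [Real.pi_pos], hlam⟩
    refine le_antisymm ((measureReal_mono (s₂ := {0}) ?_).trans (by simp [measureReal_def, stdGaussian_singleton]))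
      measureReal_nonneg
    rintro x ⟨-, hx⟩
    have hx0 : L.starProjection x = 0 := by rw [hbot]; simp
    rw [hx0, norm_zero] at hx
    exact norm_le_zero_iff.1 (nonpos_of_mul_nonpos_right hx hcos)
  rw [if_neg hk.ne']
  rcases Nat.eq_zero_or_pos (Module.finrank ℝ Lᗮ) with hl | hl
  · have hL : Module.finrank ℝ L = d := by rwa [hl, add_zero] at hfin
    have hself : ∀ x, L.starProjection x = x := by
      have hbot : Lᗮ = ⊥ := Submodule.finrank_eq_zero.1 hl
      intro x
      rw [Submodule.starProjection_eq_self_iff, Submodule.orthogonal_eq_bot_iff.1 hbot]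
      trivial
    rw [hL, g, if_pos rfl, one_mul]
    congr 1
    ext x
    simp only [mem_ofPred_eq, and_iff_left_iff_imp, hself]
    exact fun _ ↦ mul_le_of_le_one_left (norm_nonneg x) (Real.cos_le_one lam)
  · have h := stdGaussian_biconic_sector L hk hl (measurableSet_activeEvent (s := s) hC I hη.1)
      (smul_mem_activeEvent hη) h0 hlam
    rw [finrank_euclideanSpace_fin] at h
    have hg : 0 ≤ g d (Module.finrank ℝ L) lam := by
      have := g_nonneg hk hl h0 hlam
      rwa [hfin] at this
    rw [measureReal_def, h, ENNReal.toReal_mul, ENNReal.toReal_ofReal hg, measureReal_def]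

/-- Decomposition of the measure of a set according to the active constraints. -/
theorem stdGaussian_real_eq_sum_active (hs : ∀ x : Euc d, x ∈ C ↔ ∀ y ∈ s, inner ℝ x y ≤ 0)
    (hC : IsClosed (C : Set (Euc d))) (B : Set (Euc d)) :
    (stdGaussian (Euc d)).real B =
      ∑ I ∈ s.powerset, (stdGaussian (Euc d)).real {x | active s (proj C x) = I ∧ x ∈ B} := by
  -- Restricting the measure to `B` requires measurability of the partition only, not of `B`.
  have h := sum_measureReal_preimage_singleton (μ := (stdGaussian (Euc d)).restrict B)
    (f := fun x ↦ active s (proj C x)) s.powerset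
    (fun I _ ↦ measurableSet_active_proj hs hC I)
  have huniv : (fun x ↦ active s (proj C x)) ⁻¹' (s.powerset : Set (Finset (Euc d))) = univ := by
    ext x
    simp only [mem_preimage, Finset.mem_coe, Finset.mem_powerset, mem_univ, iff_true]
    exact fun y hy ↦ (mem_active.1 hy).1
  rw [huniv, measureReal_restrict_apply_univ] at h
  rw [← h]
  refine Finset.sum_congr rfl fun I _ ↦ ?_
  exact measureReal_restrict_apply (measurableSet_active_proj hs hC I)

theorem Ω_eq_sum_active (hs : ∀ x : Euc d, x ∈ C ↔ ∀ y ∈ s, inner ℝ x y ≤ 0)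
    (hC : IsClosed (C : Set (Euc d))) (k : ℕ) (η : Set (Euc d × Euc d)) :
    Ω k C η = ∑ I ∈ s.powerset, if Module.finrank ℝ (annihilator I) = k then
      (stdGaussian (Euc d)).real
        {x | active s (proj C x) = I ∧ (proj C x, proj (polar C) x) ∈ η} else 0 := by
  rw [Ω, stdGaussian_real_eq_sum_active hs hC]
  refine Finset.sum_congr rfl fun I _ ↦ ?_
  have hset : {x | active s (proj C x) = I ∧
      x ∈ {x | proj C x ∈ skel k C ∧ (proj C x, proj (polar C) x) ∈ η}} =
      {x | active s (proj C x) = I ∧ Module.finrank ℝ (annihilator I) = k ∧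
        (proj C x, proj (polar C) x) ∈ η} := by
    ext x
    refine and_congr_right ?_
    rintro rfl
    rw [mem_ofPred_eq, mem_skel_iff hs (proj_mem hC x)]
  rw [hset]
  split_ifs with h <;> simp [h]

end

end ConicSupport

theorem theorem3p2 (d : ℕ) (hd : 2 ≤ d) (C : PointedCone ℝ (ConicSupport.Euc d))
    (hC : ConicSupport.IsPolyhedral C) (hdim : 0 < ConicSupport.dim C)
    (η : Set (ConicSupport.Euc d × ConicSupport.Euc d)) (hη : ConicSupport.IsBiconic η)
    (lam : ℝ) (hlam0 : 0 ≤ lam) (hlam : lam < Real.pi / 2) :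
    (stdGaussian (ConicSupport.Euc d)).real (ConicSupport.angParallel lam C η) =
      ∑ k ∈ Finset.Icc 1 d, ConicSupport.g d k lam * ConicSupport.Ω k C η := by
  have hclosed := hC.isClosed
  obtain ⟨s, hs⟩ := hC
  rw [ConicSupport.stdGaussian_real_eq_sum_active hs hclosed]
  simp_rw [ConicSupport.Ω_eq_sum_active hs hclosed, Finset.mul_sum]
  rw [Finset.sum_comm]
  refine Finset.sum_congr rfl fun I _ ↦ ?_
  rw [ConicSupport.stdGaussian_angParallel_inter_active (by lia) hs hclosed hη hlam0 hlam I]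
  -- For fixed `I` only `k = dim L` survives in the sum over `k`. If this dimension is `0`, it lies
  -- outside the range of summation, matching the zero contribution on the left.
  simp_rw [mul_ite, mul_zero]
  rw [Finset.sum_ite_eq]
  have hle : Module.finrank ℝ (ConicSupport.annihilator I) ≤ d :=
    (Submodule.finrank_le _).trans (finrank_euclideanSpace_fin (𝕜 := ℝ)).le
  by_cases h : Module.finrank ℝ (ConicSupport.annihilator I) = 0
  · simp [h]
  · rw [if_neg h, if_pos (Finset.mem_Icc.2 ⟨Nat.one_le_iff_ne_zero.2 h, hle⟩)]
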